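/- **Setting.** Fix a linearly ordered set $\mathrm{PROP}$ of proposition symbols, some of which are *distinguished*. For a finite $\Pi\subseteq\mathrm{PROP}$ let $\Pi_1$ be the set of its distinguished symbols. In a Kripke model $M=(W,R,V)$ over $\Pi$ ($W\neq\emptyset$), the *local input* of a node $w$ is the string of truth values at $w$ of the symbols of $\Pi$, in increasing order, and its *identifier* is the string of truth values at $w$ of the symbols of $\Pi_1$, in increasing order. $\mathcal K(\Pi,\Delta)$ is the class of finite Kripke models over $\Pi$ in which distinct nodes have distinct identifiers and all out-degrees are at most $\Delta$. The $i$th neighbour of $w$ is its successor with the $i$th smallest identifier in the lexicographic order. *Circuits.* A Boolean circuit is a finite directed acyclic graph whose nodes (gates) are input gates (of fan-in $0$), $\wedge$- and $\vee$-gates (of any fan-in; fan-in $0$ gives the constants $1$ and $0$) or $\neg$-gates (of fan-in $1$); its output gates are the gates of fan-out $0$; input and output gates are linearly ordered. Its size is its number of gates, its depth the length of a longest path from a gate of fan-in $0$ to an output gate. A *message passing circuit* (MPC) for $(\Pi,\Delta)$ is a Boolean circuit $C$ with $|\Pi|+k(\Delta+1)$ input gates and $k$ output gates, for some $k\in\mathbb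 N$, together with sets of attention and print positions in $\{1,\dots,k\}$. On $M\in\mathcal K(\Pi,\Delta)$ it defines states $f_n(w)\in\{0,1\}^k$: with $\bar t_w$ the local input of $w$, $f_0(w)=C(\bar t_w\cdot 0^{k(\Delta+1)})$ and $f_{n+1}(w)=C(\bar t_w\cdot\bar s_0\cdots\bar s_\Delta)$, where $\bar s_0=f_n(w)$ and, for $j\ge 1$, $\bar s_j=f_n(v)$ if $v$ is the $j$th neighbour of $w$, and $\bar s_j=0^k$ if $w$ has fewer than $j$ neighbours. *Programs.* Let $V_0,V_1,\dots$ be schema variables, ordered by index. A $\Pi$-*program* of modal substitution calculus (MSC) consists of a finite nonempty set of schema variables (its head predicates), for each head predicate $Y$ a terminal clause $Y(0):=\varphi_Y$ and an iteration clause $Y:=\psi_Y$, and sets of attention and print head predicates. Here $\varphi_Y$ is built from $\top$ and symbols in $\Pi$ with $\neg,\wedge,\Diamond$, and $\psi_Y$ is built in the same way but may also use head predicates. Put $Y^0=\varphi_Y$, and let $Y^{n+1}$ be $\psi_Y$ with every head predicate $Z$ replaced by $Z^n$. The state of the program at $w$ in round $n$ is the string of truth values of the formulas $Y^n$ at $w$,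 in the order of the head predicates. The length of a program is the number of occurrences of proposition symbols, head predicates and operators $\top,\neg,\wedge,\Diamond$ in its clauses. *Output.* An MPC or a program *outputs* $\bar p$ at $w$ in round $n$ if $n$ is the first round in which some attention bit at $w$ is $1$, and $\bar p$ is the string of print bits at $w$ in round $n$. An MPC for $(\Pi,\Delta)$ and a $\Pi$-program are *(acceptance) equivalent* if for every $M\in\mathcal K(\Pi,\Delta)$ and every node $w$ of $M$, they output the same string at $w$ (possibly in different rounds) or neither outputs anything at $w$. **Theorem.** There are a constant $T$ and, for every $c\in\mathbb N$, a constant $K_c$ such that for every finite $\Pi\subseteq\mathrm{PROP}$, every $\Delta\in\mathbb N$ and every MPC $C$ for $(\Pi,\Delta)$ there is a $\Pi$-program $\Lambda$ of MSC with the following properties. 1. $\Lambda$ and $C$ are acceptance equivalent. 2. For every $c$ such that all gates of $C$ have fan-in at most $c$, the length of $\Lambda$ is at most $K_c\cdot|C|$, where $|C|$ is the size of $C$, provided that $C$ has at least one gate. 3. Whenever $C$ outputs $\bar p$ at a node $w$ of some $M\in\mathcal K(\Pi,\Delta)$ in round $n$ (that is, after the $n+1$ rounds $0,\dots,n$), $\Lambda$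 outputs $\bar p$ at $w$ in some round $n'$ with $n'+1\le T\,(d+2^{|\Pi_1|})\,(n+1)$, where $d$ is the depth of $C$. -/

import Mathlib

universe u v

/-! ### Bit sequences: acceptance and output -/

/-- The sequence `S` of bit strings, with positions in `ι`, accepts in round `n` with respect to
the set `A` of attention positions: some attention bit is `1` in round `n`, and all attention bits
are `0` in all earlier rounds. -/
def AcceptsAt {ι : Type*} (S : ℕ → ι → Bool) (A : Finset ι) (n : ℕ) : Prop :=
  (∃ a ∈ A, S n a = true) ∧ ∀ m < n, ∀ a ∈ A, S m a = false

/-- The substring of the bit string `b` with positions in `P`, read in increasing order. -/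
def substring {ι : Type*} [LinearOrder ι] (b : ι → Bool) (P : Finset ι) : List Bool :=
  (P.sort (· ≤ ·)).map b

/-- The sequence `S` accepts in round `n`, and its string of print bits in that round is `s`. -/
def OutputsAt {ι : Type*} [LinearOrder ι] (S : ℕ → ι → Bool) (A P : Finset ι) (n : ℕ)
    (s : List Bool) : Prop :=
  AcceptsAt S A n ∧ s = substring (S n) P

/-! ### Kripke models with identifiers -/

section Kripke

open Classical in
/-- The distinguished (identifier) propositions among `Π`, where `ID` is the set of all
distinguished proposition symbols. -/
noncomputable def distinguished {PROP : Type v} (ID : Set PROP) (Pi : Finset PROP) :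
    Finset PROP :=
  Pi.filter (· ∈ ID)

theorem mem_of_mem_distinguished {PROP : Type v} {ID : Set PROP} {Pi : Finset PROP} {p : PROP}
    (h : p ∈ distinguished ID Pi) : p ∈ Pi := by
  classical
  rw [distinguished, Finset.mem_filter] at h
  exact h.1

variable {PROP : Type v} [LinearOrder PROP]

/-- A Kripke model interpreting precisely the proposition symbols in `Π`. -/
structure KripkeModel (Pi : Finset PROP) where
  W : Type u
  nonempty : Nonempty W
  R : W → W → Prop
  V : Pi → Set W

namespace KripkeModel

variable {Pi : Finset PROP} (M : KripkeModel.{u} Pi)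

open Classical in
/-- The local input of `w`: its `i`th bit is the truth value at `w` of the `i`th symbol of `Π`. -/
noncomputable def localInput (w : M.W) : Fin Pi.card → Bool := fun i =>
  decide (w ∈ M.V (Pi.orderIsoOfFin rfl i))

open Classical in
/-- The identifier of `w`: its `i`th bit is the truth value at `w` of the `i`th distinguished
symbol of `Π`. Identifiers are compared lexicographically (the first bit is the most significant
one, and `0 < 1`). -/
noncomputable def ident (ID : Set PROP) (w : M.W) :
    Lex (Fin (distinguished ID Pi).card → Bool) :=
  toLex fun i => decide (w ∈ M.V
    ⟨(distinguished ID Pi).orderEmbOfFin rfl i,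
      mem_of_mem_distinguished ((distinguished ID Pi).orderEmbOfFin_mem rfl i)⟩)

/-- The set of successors of `w`. -/
def succ (w : M.W) : Set M.W := {x | M.R w x}

/-- `x` is the `i`th neighbour of `w` (counting from `1`): a successor of `w` such that exactly
`i - 1` successors of `w` have a lexicographically smaller identifier. -/
def IsNeighbour (ID : Set PROP) (w : M.W) (i : ℕ) (x : M.W) : Prop :=
  x ∈ M.succ w ∧ {y ∈ M.succ w | M.ident ID y < M.ident ID x}.ncard + 1 = i

/-- Membership in the class `K(Π, Δ)` of finite Kripke models over `Π` with identifiers in which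
all out-degrees are at most `Δ`. -/
structure MemK (ID : Set PROP) (Delta : ℕ) : Prop where
  finite : Finite M.W
  ident_injective : Function.Injective (M.ident ID)
  outDegree_le : ∀ w, (M.succ w).ncard ≤ Delta

end KripkeModel

end Kripke

/-! ### Modal substitution calculus -/

/-- Schemata with proposition symbols from `P` and schema variables from `T`. -/
inductive Schema (P : Type u) (T : Type v) : Type (max u v)
  | top : Schema P T
  | prop (p : P) : Schema P T
  | var (X : T) : Schema P T
  | neg (φ : Schema P T) : Schema P T
  | and (φ ψ : Schema P T) : Schema P T
  | dia (φ : Schema P T) : Schema P T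

/-- Formulas of basic modal logic: schemata without schema variables. -/
abbrev ML (P : Type u) := Schema P Empty

namespace Schema

/-- Simultaneous replacement of all schema variables. -/
def subst {P : Type*} {T : Type*} {T' : Type*} (σ : T → Schema P T') :
    Schema P T → Schema P T'
  | top => top
  | prop p => prop p
  | var X => σ X
  | neg φ => neg (φ.subst σ)
  | and φ ψ => and (φ.subst σ) (ψ.subst σ)
  | dia φ => dia (φ.subst σ)

/-- Number of occurrences of proposition symbols, schema variables and operators. -/
def length {P : Type*} {T : Type*} : Schema P T → ℕ
  | top => 1
  | prop _ => 1
  | var _ => 1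
  | neg φ => φ.length + 1
  | and φ ψ => φ.length + ψ.length + 1
  | dia φ => φ.length + 1

end Schema

/-- Truth of a modal formula at a node. -/
def KripkeModel.Sat {PROP : Type v} [LinearOrder PROP] {Pi : Finset PROP}
    (M : KripkeModel.{u} Pi) : M.W → ML Pi → Prop
  | _, .top => True
  | w, .prop p => w ∈ M.V p
  | w, .neg φ => ¬ M.Sat w φ
  | w, .and φ ψ => M.Sat w φ ∧ M.Sat w ψ
  | w, .dia φ => ∃ x, M.R w x ∧ M.Sat x φ

/-- A `Π`-program of MSC. The schema variable `V_i` is represented by `i : ℕ`, with the usual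
order. -/
structure MSCProgram {PROP : Type v} (Pi : Finset PROP) where
  /-- the finite nonempty set of head predicates -/
  head : Finset ℕ
  head_nonempty : head.Nonempty
  /-- bodies of the terminal clauses -/
  terminal : head → ML Pi
  /-- bodies of the iteration clauses -/
  iteration : head → Schema Pi head
  /-- attention predicates -/
  attention : Finset head
  /-- print predicates -/
  print : Finset head

namespace MSCProgram

variable {PROP : Type v} {Pi : Finset PROP} (L : MSCProgram Pi)

/-- The `n`th iteration formula of each head predicate. -/
def iterFormula : ℕ → L.head → ML Pi
  | 0, Y => L.terminal Y
  | n + 1, Y => (L.iteration Y).subst (iterFormula n)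

/-- The length of a program: the number of occurrences of proposition symbols, head predicates and
operators. Each head predicate occurs once to the left of `:=` in its terminal clause and once in
its iteration clause. -/
def length : ℕ :=
  ∑ Y : L.head, ((1 + (L.terminal Y).length) + (1 + (L.iteration Y).length))

variable [LinearOrder PROP]

open Classical in
/-- The global configuration of round `n`: the bit of the head predicate `Y` at `w` is the truth
value of the `n`th iteration formula of `Y`. -/
noncomputable def config (M : KripkeModel.{u} Pi) (w : M.W) (n : ℕ) : L.head → Bool :=
  fun Y => decide (M.Sat w (L.iterFormula n Y))

/-- The program outputs the string `s` at `w` in round `n`. -/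
def Outputs (M : KripkeModel.{u} Pi) (w : M.W) (n : ℕ) (s : List Bool) : Prop :=
  OutputsAt (L.config M w) L.attention L.print n s

end MSCProgram

/-! ### Boolean circuits -/

inductive GateKind
  | input
  | and
  | or
  | not

/-- A Boolean circuit with `n` input gates and `k` output gates, both linearly ordered. The gates
are the elements of `Fin size`, and `child g` is the set of gates with an edge to `g`. Gates labeled
`and` or `or` may have fan-in zero; they are then constants. -/
structure Circuit (n k : ℕ) where
  /-- number of gates -/
  size : ℕ
  kind : Fin size → GateKind
  child : Fin size → Finset (Fin size)
  acyclic : ∀ g, ¬ Relation.TransGen (fun h g => h ∈ child g) g g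
  child_input : ∀ g, kind g = GateKind.input → child g = ∅
  child_not : ∀ g, kind g = GateKind.not → (child g).card = 1
  /-- the input gates in order -/
  inputs : Fin n ≃ {g // kind g = GateKind.input}
  /-- the output gates (those of fan-out zero) in order -/
  outputs : Fin k ≃ {g : Fin size // ∀ h, g ∉ child h}

namespace Circuit

variable {n k : ℕ} (C : Circuit n k)

theorem wf : WellFounded (fun h g => h ∈ C.child g) := by
  have : Std.Irrefl (Relation.TransGen (fun h g => h ∈ C.child g)) := ⟨C.acyclic⟩
  exact Subrelation.wf (fun h => Relation.TransGen.single h)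
    (Finite.wellFounded_of_trans_of_irrefl (Relation.TransGen (fun h g => h ∈ C.child g)))

/-- The value of a gate on the input string `x`. In `Bool`, where `false < true`, the infimum of a
finite family is its conjunction (`true` if empty) and the supremum is its disjunction (`false` if
empty). -/
noncomputable def value (x : Fin n → Bool) (g : Fin C.size) : Bool :=
  match hk : C.kind g with
  | .input => x (C.inputs.symm ⟨g, hk⟩)
  | .and => (C.child g).attach.inf fun h => value x h.1
  | .or => (C.child g).attach.sup fun h => value x h.1
  | .not => !((C.child g).attach.sup fun h => value x h.1)
termination_by C.wf.wrap g
decreasing_by all_goals exact h.2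

/-- The function computed by the circuit. -/
noncomputable def eval (x : Fin n → Bool) : Fin k → Bool := fun i => C.value x (C.outputs i)

/-- The height of a gate: the length of a longest path from a gate of fan-in zero to it. -/
def height (g : Fin C.size) : ℕ :=
  (C.child g).attach.sup fun h => height h.1 + 1
termination_by C.wf.wrap g
decreasing_by exact h.2

/-- The depth: the length of a longest path from a gate of fan-in zero to an output gate. -/
def depth : ℕ := Finset.univ.sup fun i : Fin k => C.height (C.outputs i)

/-- All gates have fan-in at most `c`. -/
def FanInLE (c : ℕ) : Prop := ∀ g, (C.child g).card ≤ c

end Circuit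

/-! ### Message passing circuits -/

/-- A message passing circuit for `(Π, Δ)`. -/
structure MPC {PROP : Type v} (Pi : Finset PROP) (Delta : ℕ) where
  /-- state length -/
  k : ℕ
  circuit : Circuit (Pi.card + (Delta + 1) * k) k
  /-- attention bits -/
  attention : Finset (Fin k)
  /-- print bits -/
  print : Finset (Fin k)

namespace MPC

variable {PROP : Type v} [LinearOrder PROP] {Pi : Finset PROP} {Delta : ℕ} (C : MPC Pi Delta)

/-- The concatenation `t · s 0 ⋯ s Δ`. -/
def inputString (t : Fin Pi.card → Bool) (s : Fin (Delta + 1) → Fin C.k → Bool) :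
    Fin (Pi.card + (Delta + 1) * C.k) → Bool :=
  Fin.append t fun i => s (finProdFinEquiv.symm i).1 (finProdFinEquiv.symm i).2

open Classical in
/-- The strings received by `w` if the current global configuration is `f`: string `0` is the state
of `w`, string `j ≥ 1` is the state of the `j`th neighbour of `w`, or `0 ⋯ 0` if there is none. -/
noncomputable def received (ID : Set PROP) (M : KripkeModel.{u} Pi) (f : M.W → Fin C.k → Bool)
    (w : M.W) (j : Fin (Delta + 1)) (b : Fin C.k) : Bool :=
  if (j : ℕ) = 0 then f w b else decide (∃ x, M.IsNeighbour ID w j x ∧ f x b = true)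

/-- The global configuration of round `n`. -/
noncomputable def config (ID : Set PROP) (M : KripkeModel.{u} Pi) : ℕ → M.W → Fin C.k → Bool
  | 0, w => C.circuit.eval (C.inputString (M.localInput w) fun _ _ => false)
  | n + 1, w =>
      C.circuit.eval (C.inputString (M.localInput w) (C.received ID M (config ID M n) w))

/-- The circuit outputs the string `s` at `w` in round `n`. -/
def Outputs (ID : Set PROP) (M : KripkeModel.{u} Pi) (w : M.W) (n : ℕ) (s : List Bool) : Prop :=
  OutputsAt (fun m => C.config ID M m w) C.attention C.print n s

/-- Acceptance equivalence of an MPC for `(Π, Δ)` and a `Π`-program: on every model suitable for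
both and at every node, they produce the same output or neither produces an output. -/
def Equivalent (ID : Set PROP) (L : MSCProgram Pi) : Prop :=
  ∀ M : KripkeModel.{u} Pi, M.MemK ID Delta → ∀ (w : M.W) (s : List Bool),
    (∃ n, C.Outputs ID M w n s) ↔ ∃ n, L.Outputs M w n s

end MPC

/-! The program keeps one variable per state bit, per received bit and per gate, and simulates a
communication round in a fixed period of `d + 2 + (m + 2 ^ m)` steps, where `d` is the depth and `m`
the identifier length. All nodes run in lockstep, because the clock variables evolve identically
everywhere.

In the first part of a period, a pulse travels through `d + 2` delay variables while every gate is
recomputed at each step from its children. After `t` steps the gates of height below `t` are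
correct, whatever they held before (`Stores.add`). When the pulse arrives, the outputs are loaded as
the new state, the received strings are erased and a binary counter starts.

In the second part, the counter runs through all `m`-bit numbers. A node is called when the counter
equals its identifier, so at most one node is called at a time, and in lexicographic order. A
diamond can then read the state of a single successor. Flags count the successors already met, which
tells which slot receives that state (`Stores.collect`). To keep clauses of bounded length, the
carry and the comparison with the identifier advance by one bit per step: at counter time `t`, bit
`i` shows bit `i` of `t - i` (`Counting.succ`). This pipeline costs only `m` extra steps.

The state variables thus display each circuit state for exactly one period, after an initial
silence, so the first accepting state and its print bits are preserved (`outputs_simProgram`). The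
number of variables is linear in the circuit size, and only gate clauses have length depending on
the fan-in (`length_simProgram_le`). -/

/-! ### Semantics of schemata -/

namespace Schema

/-- Truth of a schema at a node, for a given interpretation of the schema variables. -/
def Holds {PROP : Type v} [LinearOrder PROP] {Pi : Finset PROP} (M : KripkeModel.{u} Pi)
    {T : Type*} (val : T → M.W → Prop) : M.W → Schema Pi T → Prop
  | _, .top => True
  | w, .prop p => w ∈ M.V p
  | w, .var X => val X w
  | w, .neg φ => ¬ Holds M val w φ
  | w, .and φ ψ => Holds M val w φ ∧ Holds M val w ψ
  | w, .dia φ => ∃ x, M.R w x ∧ Holds M val x φ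

/-- Lets iteration formulas be evaluated one round at a time: substituted formulas act only through
their truth sets, so the growing formulas never need to be inspected. -/
theorem sat_subst {PROP : Type v} [LinearOrder PROP] {Pi : Finset PROP} (M : KripkeModel.{u} Pi)
    {T : Type*} (σ : T → ML Pi) (φ : Schema Pi T) (w : M.W) :
    M.Sat w (φ.subst σ) ↔ φ.Holds M (fun X x => M.Sat x (σ X)) w := by
  induction φ generalizing w with
  | top => simp [subst, Holds, KripkeModel.Sat]
  | prop p => simp [subst, Holds, KripkeModel.Sat]
  | var X => simp [subst, Holds]
  | neg φ ih => simp [subst, Holds, KripkeModel.Sat, ih]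
  | and φ ψ ih₁ ih₂ => simp [subst, Holds, KripkeModel.Sat, ih₁, ih₂]
  | dia φ ih => simp [subst, Holds, KripkeModel.Sat, ih]

theorem holds_subst_var {PROP : Type v} [LinearOrder PROP] {Pi : Finset PROP}
    (M : KripkeModel.{u} Pi) {T T' : Type*} (f : T → T') (val : T' → M.W → Prop)
    (φ : Schema Pi T) (w : M.W) :
    (φ.subst fun X => var (f X)).Holds M val w ↔ φ.Holds M (fun X => val (f X)) w := by
  induction φ generalizing w <;> simp_all [subst, Holds]

theorem length_subst_var {P T T' : Type*} (f : T → T') (φ : Schema P T) :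
    (φ.subst fun X => var (f X)).length = φ.length := by
  induction φ <;> simp_all [subst, length]

/-- Falsum. -/
def bot {P T : Type*} : Schema P T := neg top

/-- Disjunction. -/
def or {P T : Type*} (φ ψ : Schema P T) : Schema P T := neg (and (neg φ) (neg ψ))

/-- If `φ` then `ψ` else `χ`. -/
def cond {P T : Type*} (φ ψ χ : Schema P T) : Schema P T := or (and φ ψ) (and (neg φ) χ)

/-- Conjunction of a list of schemata. -/
def conj {P T : Type*} : List (Schema P T) → Schema P T
  | [] => top
  | φ :: l => and φ (conj l)

/-- Disjunction of a list of schemata. -/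
def disj {P T : Type*} (l : List (Schema P T)) : Schema P T := neg (conj (l.map neg))

/-! ### Truth of the derived connectives -/

section Holds

variable {PROP : Type v} [LinearOrder PROP] {Pi : Finset PROP} {M : KripkeModel.{u} Pi}
  {T : Type*} {val : T → M.W → Prop} {w : M.W} {φ ψ χ : Schema Pi T}

@[simp] theorem holds_top : (top : Schema Pi T).Holds M val w ↔ True := Iff.rfl

@[simp] theorem holds_prop {p : Pi} : (prop p : Schema Pi T).Holds M val w ↔ w ∈ M.V p := Iff.rfl

@[simp] theorem holds_var {X : T} : (var X : Schema Pi T).Holds M val w ↔ val X w := Iff.rfl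

@[simp] theorem holds_neg : (neg φ).Holds M val w ↔ ¬ φ.Holds M val w := Iff.rfl

@[simp] theorem holds_and : (and φ ψ).Holds M val w ↔ φ.Holds M val w ∧ ψ.Holds M val w := Iff.rfl

@[simp] theorem holds_dia : (dia φ).Holds M val w ↔ ∃ x, M.R w x ∧ φ.Holds M val x := Iff.rfl

@[simp] theorem holds_or : (or φ ψ).Holds M val w ↔ φ.Holds M val w ∨ ψ.Holds M val w := by
  simp only [or, holds_neg, holds_and]; tauto

@[simp] theorem holds_cond : (cond φ ψ χ).Holds M val w ↔
    (φ.Holds M val w ∧ ψ.Holds M val w) ∨ (¬ φ.Holds M val w ∧ χ.Holds M val w) := by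
  simp [cond]

@[simp] theorem holds_conj {l : List (Schema Pi T)} :
    (conj l).Holds M val w ↔ ∀ φ ∈ l, φ.Holds M val w := by
  induction l <;> simp_all [conj]

@[simp] theorem holds_disj {l : List (Schema Pi T)} :
    (disj l).Holds M val w ↔ ∃ φ ∈ l, φ.Holds M val w := by
  simp [disj]

end Holds

/-! ### Lengths of conjunctions and disjunctions of variables -/

theorem length_conj_map_var {P T α : Type*} (f : α → T) (l : List α) :
    (conj (l.map fun a => (var (f a) : Schema P T))).length = 2 * l.length + 1 := by
  induction l with
  | nil => rfl
  | cons a l ih => simp only [List.map_cons, conj, length, ih, List.length_cons]; ring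

theorem length_disj_map_var {P T α : Type*} (f : α → T) (l : List α) :
    (disj (l.map fun a => (var (f a) : Schema P T))).length = 3 * l.length + 2 := by
  induction l with
  | nil => rfl
  | cons a l ih =>
    simp only [disj, List.map_cons, conj, length, List.length_cons] at ih ⊢
    omega

end Schema

/-! ### Programs over arbitrary finite sets of variables -/

namespace MSCProgram

variable {PROP : Type v} {Pi : Finset PROP} {ι : Type*} [Fintype ι] [Nonempty ι]

/-- The head predicates that represent a finite type of variables, in bijection with that type. -/
noncomputable def headEquiv (e : ι ↪ ℕ) : ι ≃ (Finset.univ.map e : Finset ℕ) :=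
  Equiv.ofBijective (fun i => ⟨e i, Finset.mem_map_of_mem e (Finset.mem_univ i)⟩) <| by
    refine ⟨fun i j h => e.injective (congrArg Subtype.val h), ?_⟩
    rintro ⟨n, hn⟩
    obtain ⟨i, -, rfl⟩ := Finset.mem_map.1 hn
    exact ⟨i, rfl⟩

/-- The program with variables in `ι`, renamed along `e`. -/
noncomputable def ofVars (e : ι ↪ ℕ) (init : ι → ML Pi) (step : ι → Schema Pi ι)
    (A P : Finset ι) : MSCProgram Pi where
  head := Finset.univ.map e
  head_nonempty := Finset.univ_nonempty.map
  terminal Y := init ((headEquiv e).symm Y)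
  iteration Y := (step ((headEquiv e).symm Y)).subst fun X => .var (headEquiv e X)
  attention := A.map (headEquiv e).toEmbedding
  print := P.map (headEquiv e).toEmbedding

variable (e : ι ↪ ℕ) (init : ι → ML Pi) (step : ι → Schema Pi ι) (A P : Finset ι)

theorem length_ofVars_le {B : ℕ}
    (h : ∀ i, (1 + (init i).length) + (1 + (step i).length) ≤ B) :
    (ofVars e init step A P).length ≤ B * Fintype.card ι := by
  have h₁ : (ofVars e init step A P).length =
      ∑ Y : (Finset.univ.map e : Finset ℕ), ((1 + (init ((headEquiv e).symm Y)).length) +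
        (1 + (step ((headEquiv e).symm Y)).length)) := by
    refine Finset.sum_congr rfl fun Y _ => ?_
    simp only [ofVars, Schema.length_subst_var]
  rw [h₁, ← (headEquiv e).sum_comp]
  refine (Finset.sum_le_card_nsmul _ _ B fun i _ => ?_).trans (by simp [mul_comm])
  simpa using h i

variable [LinearOrder PROP] (M : KripkeModel.{u} Pi)

/-- The truth value of a variable at a node in round `n`. -/
def run (n : ℕ) (X : ι) (w : M.W) : Prop :=
  match n with
  | 0 => M.Sat w (init X)
  | n + 1 => (step X).Holds M (run n) w

/-- Reduces the program to a synchronous machine on truth values; from here on only `run` matters.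
-/
theorem sat_iterFormula_ofVars (n : ℕ) (X : ι) (w : M.W) :
    M.Sat w ((ofVars e init step A P).iterFormula n (headEquiv e X)) ↔
      run init step M n X w := by
  induction n generalizing X w with
  | zero => simp [iterFormula, ofVars, run]
  | succ n ih =>
    have h : (ofVars e init step A P).iterFormula (n + 1) (headEquiv e X) =
        ((step X).subst fun X => .var (headEquiv e X)).subst
          ((ofVars e init step A P).iterFormula n) := by
      simp [iterFormula, ofVars]
    rw [h, run]
    refine (Schema.sat_subst M ((ofVars e init step A P).iterFormula n) _ w).trans ?_
    refine (Schema.holds_subst_var M (headEquiv e)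
      (fun X x => M.Sat x ((ofVars e init step A P).iterFormula n X)) (step X) w).trans ?_
    have : (fun X x => M.Sat x ((ofVars e init step A P).iterFormula n (headEquiv e X))) =
        run init step M n := by
      funext X x; exact propext (ih X x)
    rw [this]

theorem substring_map {α β : Type*} [LinearOrder α] [LinearOrder β] (f : α ↪o β) (s : Finset α)
    (b : β → Bool) : substring b (s.map f.toEmbedding) = substring (b ∘ f) s := by
  have h : (s.map f.toEmbedding).sort (· ≤ ·) = (s.sort (· ≤ ·)).map f :=
    (Finset.map_sort (r := (· ≤ ·)) (r' := (· ≤ ·)) f.toEmbedding s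
      fun a _ b _ => (f.le_iff_le).symm).symm
  rw [substring, substring, h, List.map_map]

/-- If the attention and print variables are `f a` for an order-preserving `f`, the output of the
program is determined by the sequence of the truth values of the variables `f a`. -/
theorem outputs_ofVars_iff {α : Type*} [LinearOrder α] (f : α ↪ ι)
    (hf : StrictMono fun a => e (f a)) (A P : Finset α) (w : M.W) (S : ℕ → α → Bool)
    (hS : ∀ n a, S n a = true ↔ run init step M n (f a) w) (n : ℕ) (s : List Bool) :
    (ofVars e init step (A.map f) (P.map f)).Outputs M w n s ↔ OutputsAt S A P n s := by
  set L := ofVars e init step (A.map f) (P.map f) with hL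
  -- Print strings are read in the order of the head predicates, so the renaming has to preserve
  -- order on the observed variables; the others may be numbered arbitrarily.
  let F : α ↪o (Finset.univ.map e : Finset ℕ) :=
    OrderEmbedding.ofStrictMono (fun a => headEquiv e (f a)) fun a b h => hf h
  have hc (n : ℕ) (a : α) : L.config M w n (F a) = S n a := by
    rw [Bool.eq_iff_iff, hS, ← sat_iterFormula_ofVars e init step (A.map f) (P.map f)]
    exact @decide_eq_true_iff _ (Classical.propDecidable _)
  have hmap (B : Finset α) : (B.map f).map (headEquiv e).toEmbedding = B.map F.toEmbedding := by
    rw [Finset.map_map]; rfl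
  have hA : L.attention = A.map F.toEmbedding := hmap A
  have hP : L.print = P.map F.toEmbedding := hmap P
  have hP' : substring (L.config M w n) L.print = substring (S n) P := by
    rw [hP]
    refine (substring_map F P (L.config M w n)).trans ?_
    congr 1
    funext a
    exact hc n a
  rw [Outputs, OutputsAt, OutputsAt, hP']
  refine and_congr ?_ Iff.rfl
  rw [AcceptsAt, AcceptsAt, hA]
  have h₁ (n : ℕ) (a : α) : L.config M w n (F.toEmbedding a) = S n a := hc n a
  refine and_congr ⟨?_, ?_⟩ ⟨?_, ?_⟩
  · rintro ⟨Y, hY, h⟩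
    obtain ⟨a, ha, rfl⟩ := Finset.mem_map.1 hY
    exact ⟨a, ha, (h₁ n a).symm.trans h⟩
  · rintro ⟨a, ha, h⟩
    exact ⟨F a, Finset.mem_map_of_mem _ ha, (h₁ n a).trans h⟩
  · intro h m hm a ha
    exact (h₁ m a).symm.trans (h m hm _ (Finset.mem_map_of_mem _ ha))
  · intro h m hm Y hY
    obtain ⟨a, ha, rfl⟩ := Finset.mem_map.1 hY
    exact (h₁ m a).trans (h m hm a ha)

end MSCProgram

/-! ### Stretching a bit sequence in time -/

section Stretch

variable {ι : Type*} [LinearOrder ι] {S S' : ℕ → ι → Bool} {A P : Finset ι} {a Q : ℕ}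

/-- Any time before the start of block `n` lies in the silent prefix or in an earlier block, where
the attention bits are still `0`. -/
theorem outputsAt_of_stretch (hQ : 0 < Q) (h₀ : ∀ t < a, ∀ i, S' t i = false)
    (h : ∀ n, ∀ r < Q, S' (a + n * Q + r) = S n) {n : ℕ} {s : List Bool}
    (ho : OutputsAt S A P n s) : OutputsAt S' A P (a + n * Q) s := by
  obtain ⟨⟨⟨i, hi, hi'⟩, hm⟩, rfl⟩ := ho
  have hn : S' (a + n * Q) = S n := h n 0 hQ
  refine ⟨⟨⟨i, hi, by rw [hn, hi']⟩, fun t ht j hj => ?_⟩, by rw [hn]⟩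
  by_cases hta : t < a
  · exact h₀ t hta j
  have hlt : (t - a) / Q < n := (Nat.div_lt_iff_lt_mul hQ).2 (by omega)
  have ht' := h ((t - a) / Q) ((t - a) % Q) (Nat.mod_lt _ hQ)
  have : a + (t - a) / Q * Q + (t - a) % Q = t := by
    have := Nat.div_add_mod' (t - a) Q
    omega
  rw [this] at ht'
  rw [ht', hm _ hlt j hj]

/-- The accepting time cannot lie in the silent prefix, so it lies in some block; the first moments
of all earlier blocks precede it and hence are not accepting. -/
theorem exists_outputsAt_of_stretch (hQ : 0 < Q) (h₀ : ∀ t < a, ∀ i, S' t i = false)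
    (h : ∀ n, ∀ r < Q, S' (a + n * Q + r) = S n) {t : ℕ} {s : List Bool}
    (ho : OutputsAt S' A P t s) : ∃ n, OutputsAt S A P n s := by
  obtain ⟨⟨⟨i, hi, hi'⟩, hm⟩, rfl⟩ := ho
  have hta : a ≤ t := by
    by_contra hta
    rw [h₀ t (by omega) i] at hi'
    exact Bool.false_ne_true hi'
  have ht' := h ((t - a) / Q) ((t - a) % Q) (Nat.mod_lt _ hQ)
  have hdm : a + (t - a) / Q * Q + (t - a) % Q = t := by
    have := Nat.div_add_mod' (t - a) Q
    omega
  rw [hdm] at ht'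
  refine ⟨(t - a) / Q, ⟨⟨i, hi, by rw [← ht', hi']⟩, fun m hmn j hj => ?_⟩, by rw [ht']⟩
  rw [← h m 0 hQ]
  refine hm _ ?_ j hj
  have := Nat.mul_lt_mul_of_pos_right hmn hQ
  omega

end Stretch

/-! ### Circuits: values, heights and numbers of gates -/

namespace Circuit

variable {n k : ℕ} (C : Circuit n k) (x : Fin n → Bool) {g : Fin C.size}

theorem value_input (hk : C.kind g = .input) : C.value x g = x (C.inputs.symm ⟨g, hk⟩) := by
  rw [value]
  split <;> simp_all

theorem value_and_iff (hk : C.kind g = .and) :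
    C.value x g = true ↔ ∀ h ∈ C.child g, C.value x h = true := by
  rw [value]
  split
  all_goals simp_all
  rw [← top_eq_true, Finset.inf_eq_top_iff]

theorem sup_eq_true_iff {α : Type*} (s : Finset α) (f : α → Bool) :
    s.sup f = true ↔ ∃ h ∈ s, f h = true := by
  have h : s.sup f = false ↔ ∀ h ∈ s, f h = false := by
    rw [← bot_eq_false, Finset.sup_eq_bot_iff]
  rw [← Bool.not_eq_false, h]
  simp

theorem value_or_iff (hk : C.kind g = .or) :
    C.value x g = true ↔ ∃ h ∈ C.child g, C.value x h = true := by
  rw [value]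
  split
  all_goals simp_all [sup_eq_true_iff]

theorem value_not_iff (hk : C.kind g = .not) :
    C.value x g = true ↔ ¬ ∃ h ∈ C.child g, C.value x h = true := by
  rw [value]
  split
  all_goals simp_all
  rw [← Bool.not_eq_true, sup_eq_true_iff]
  simp

theorem height_lt {h : Fin C.size} (hg : h ∈ C.child g) : C.height h < C.height g := by
  rw [height.eq_def C g]
  exact Finset.le_sup (f := fun h : {h // h ∈ C.child g} => C.height h.1 + 1)
    (Finset.mem_attach _ ⟨h, hg⟩)

theorem exists_height_eq (g : Fin C.size) : ∀ j ≤ C.height g, ∃ h, C.height h = j := by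
  induction g using C.wf.induction with
  | h g ih =>
    intro j hj
    rcases hj.eq_or_lt with rfl | hj
    · exact ⟨g, rfl⟩
    rw [height, Finset.lt_sup_iff] at hj
    obtain ⟨h, -, hj⟩ := hj
    exact ih h.1 h.2 j (Nat.lt_succ_iff.1 hj)

/-- All the values `0, …, height g` occur as heights, and gates of different heights are different.
-/
theorem height_lt_size (g : Fin C.size) : C.height g < C.size := by
  choose f hf using C.exists_height_eq g
  have h : Function.Injective fun j : Fin (C.height g + 1) => f j (Nat.lt_succ_iff.1 j.2) := by
    intro i j hij
    have := congrArg C.height hij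
    simp only [hf] at this
    exact Fin.ext this
  simpa using Fintype.card_le_of_injective _ h

theorem depth_lt_size (h : 0 < C.size) : C.depth < C.size := by
  rw [depth, Finset.sup_lt_iff (by simpa using h)]
  exact fun i _ => C.height_lt_size _

theorem height_output_le_depth (i : Fin k) : C.height (C.outputs i) ≤ C.depth :=
  Finset.le_sup (f := fun i : Fin k => C.height (C.outputs i)) (Finset.mem_univ i)

theorem inputs_le_size : n ≤ C.size := by
  simpa using Fintype.card_le_of_injective (fun i => (C.inputs i).1)
    (Subtype.val_injective.comp C.inputs.injective)

/-- A gate of maximal height feeds no other gate, so it is an output gate. -/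
theorem outputs_pos (h : 0 < C.size) : 0 < k := by
  have : Nonempty (Fin C.size) := ⟨⟨0, h⟩⟩
  obtain ⟨g, hg⟩ := Finite.exists_max C.height
  have hi : Nonempty (Fin k) :=
    ⟨C.outputs.symm ⟨g, fun h hh => (C.height_lt hh).not_ge (hg h)⟩⟩
  exact Fin.pos_iff_nonempty.2 hi

end Circuit

/-! ### Binary counting -/

theorem forall_testBit_iff_dvd (n i : ℕ) :
    (∀ j < i, n.testBit j = true) ↔ 2 ^ i ∣ n + 1 := by
  induction i generalizing n with
  | zero => simp
  | succ i ih =>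
    have h : (∀ j < i + 1, n.testBit j = true) ↔
        n % 2 = 1 ∧ ∀ j < i, (n / 2).testBit j = true := by
      constructor
      · refine fun h => ⟨by simpa [Nat.testBit_zero] using h 0 (by omega), fun j hj => ?_⟩
        rw [← Nat.testBit_add_one]
        exact h _ (by omega)
      · rintro ⟨h₀, h⟩ (_ | j) hj
        · simpa [Nat.testBit_zero] using h₀
        · rw [Nat.testBit_add_one]
          exact h j (by omega)
    rw [h, ih, pow_succ']
    constructor
    · rintro ⟨h₀, c, hc⟩
      refine ⟨c, ?_⟩
      rw [mul_assoc, ← hc]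
      omega
    · rintro ⟨c, hc⟩
      rw [mul_assoc] at hc
      exact ⟨by omega, c, by omega⟩

/-- Adding one flips bit `i` exactly when a carry reaches it, that is, when all lower bits are `1`.
Equivalently `2 ^ i` divides `n + 1`, which is when the quotient by `2 ^ i` increases. -/
theorem testBit_succ_iff (n i : ℕ) : (n + 1).testBit i = true ↔
    ¬ (n.testBit i = true ↔ ∀ j < i, n.testBit j = true) := by
  rw [forall_testBit_iff_dvd, Nat.testBit_eq_decide_div_mod_eq, Nat.testBit_eq_decide_div_mod_eq,
    Nat.succ_div]
  simp only [decide_eq_true_eq]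
  split_ifs with h <;> simp only [h] <;> grind

theorem forall_testBit_iff_of_lt {n m : ℕ} (h : n < 2 ^ m) :
    (∀ j < m, n.testBit j = true) ↔ n + 1 = 2 ^ m := by
  rw [forall_testBit_iff_dvd]
  exact ⟨fun hd => le_antisymm h (Nat.le_of_dvd n.succ_pos hd), fun h => h ▸ dvd_rfl⟩

/-! ### Identifiers as numbers -/

namespace KripkeModel

variable {PROP : Type v} [LinearOrder PROP] {Pi : Finset PROP} (M : KripkeModel.{u} Pi)
  (ID : Set PROP)

/-- The distinguished symbol that gives the bit of weight `2 ^ i` of identifiers. -/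
noncomputable def identSymbol {Pi : Finset PROP} (ID : Set PROP)
    (i : Fin (distinguished ID Pi).card) : Pi :=
  ⟨(distinguished ID Pi).orderEmbOfFin rfl i.rev,
    mem_of_mem_distinguished ((distinguished ID Pi).orderEmbOfFin_mem rfl i.rev)⟩

/-- The number with the identifier of `w` as its binary representation. -/
noncomputable def identNum (w : M.W) : ℕ := Nat.ofBits fun i => ofLex (M.ident ID w) i.rev

theorem identNum_lt (w : M.W) : M.identNum ID w < 2 ^ (distinguished ID Pi).card :=
  Nat.ofBits_lt_two_pow _

theorem testBit_identNum (w : M.W) (i : Fin (distinguished ID Pi).card) :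
    (M.identNum ID w).testBit i = true ↔ w ∈ M.V (identSymbol ID i) := by
  rw [identNum, Nat.testBit_ofBits_lt _ _ i.2]
  exact @decide_eq_true_iff _ (Classical.propDecidable _)

/-- The first position where the strings differ is, after reversal, the highest differing binary
digit. -/
theorem identNum_strictMono {w x : M.W} (h : M.ident ID w < M.ident ID x) :
    M.identNum ID w < M.identNum ID x := by
  obtain ⟨i, hi, hlt⟩ := h
  have hlt' : ofLex (M.ident ID w) i = false ∧ ofLex (M.ident ID x) i = true :=
    Bool.lt_iff.1 hlt
  refine Nat.lt_of_testBit i.rev ?_ ?_ fun j hj => ?_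
  · rw [identNum, Nat.testBit_ofBits_lt _ _ i.rev.2]
    simpa only [Fin.eta, Fin.rev_rev] using hlt'.1
  · rw [identNum, Nat.testBit_ofBits_lt _ _ i.rev.2]
    simpa only [Fin.eta, Fin.rev_rev] using hlt'.2
  · rw [identNum, identNum]
    by_cases hjm : j < (distinguished ID Pi).card
    · rw [Nat.testBit_ofBits_lt _ _ hjm, Nat.testBit_ofBits_lt _ _ hjm]
      refine hi _ ?_
      simp only [Fin.lt_def, Fin.val_rev] at hj ⊢
      omega
    · rw [Nat.testBit_ofBits_ge _ _ (by omega), Nat.testBit_ofBits_ge _ _ (by omega)]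

theorem identNum_lt_iff {w x : M.W} :
    M.identNum ID w < M.identNum ID x ↔ M.ident ID w < M.ident ID x := by
  refine ⟨fun h => ?_, M.identNum_strictMono ID⟩
  rcases lt_trichotomy (M.ident ID w) (M.ident ID x) with h' | h' | h'
  · exact h'
  · rw [identNum, identNum, h'] at h
    exact absurd h (lt_irrefl _)
  · exact absurd h (M.identNum_strictMono ID h').asymm

theorem identNum_injective (hM : Function.Injective (M.ident ID)) :
    Function.Injective (M.identNum ID) := by
  intro w x h
  by_contra hne
  rcases lt_or_gt_of_ne (hM.ne hne) with h' | h'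
  · exact absurd h (M.identNum_strictMono ID h').ne
  · exact absurd h (M.identNum_strictMono ID h').ne'

theorem forall_testBit_eq_identNum_iff {n : ℕ} (hn : n < 2 ^ (distinguished ID Pi).card)
    (w : M.W) :
    (∀ j < (distinguished ID Pi).card, n.testBit j = (M.identNum ID w).testBit j) ↔
      n = M.identNum ID w := by
  refine ⟨fun h => Nat.eq_of_testBit_eq fun j => ?_, fun h _ _ => by rw [h]⟩
  by_cases hj : j < (distinguished ID Pi).card
  · exact h j hj
  · have hj' : 2 ^ (distinguished ID Pi).card ≤ 2 ^ j :=
      Nat.pow_le_pow_right (by norm_num) (by omega)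
    rw [Nat.testBit_eq_false_of_lt (hn.trans_le hj'),
      Nat.testBit_eq_false_of_lt ((M.identNum_lt ID w).trans_le hj')]

end KripkeModel

/-! ### The simulating program -/

/-- Variables of the program that simulates a circuit with state length `k`, `s` gates and depth
`d`, for out-degree `Δ` and identifiers of length `m`. -/
inductive SimVar (k Δ s d m : ℕ)
  /-- the state in the current round -/
  | state (b : Fin k)
  /-- the state received from neighbour `j + 1` -/
  | slot (j : Fin Δ) (b : Fin k)
  /-- the value of a gate -/
  | gate (g : Fin s)
  /-- exactly `j` neighbours have been met in the current round -/
  | flag (j : Fin (Δ + 1))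
  /-- a pulse that measures the time needed to evaluate the circuit -/
  | delay (j : Fin (d + 2))
  /-- bit `i` of a binary counter, delayed by `i` time steps -/
  | bit (i : Fin m)
  /-- the carry into bit `i` of the counter -/
  | carry (i : Fin (m + 1))
  /-- the first `i` bits of the counter agree with the identifier -/
  | agree (i : Fin (m + 1))

namespace SimVar

variable {k Δ s d m : ℕ}

/-- The variables as a disjoint union; the state variables come first. -/
def toSum : SimVar k Δ s d m → Fin k ⊕ ((Fin Δ × Fin k) ⊕ Fin s ⊕ Fin (Δ + 1) ⊕ Fin (d + 2) ⊕
    Fin m ⊕ Fin (m + 1) ⊕ Fin (m + 1))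
  | state b => .inl b
  | slot j b => .inr (.inl (j, b))
  | gate g => .inr (.inr (.inl g))
  | flag j => .inr (.inr (.inr (.inl j)))
  | delay j => .inr (.inr (.inr (.inr (.inl j))))
  | bit i => .inr (.inr (.inr (.inr (.inr (.inl i)))))
  | carry i => .inr (.inr (.inr (.inr (.inr (.inr (.inl i))))))
  | agree i => .inr (.inr (.inr (.inr (.inr (.inr (.inr i))))))

theorem toSum_injective : Function.Injective (toSum : SimVar k Δ s d m → _) := by
  intro X Y h
  cases X <;> cases Y <;> simp_all [toSum]

noncomputable instance : Fintype (SimVar k Δ s d m) := Fintype.ofInjective _ toSum_injective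

instance : Nonempty (SimVar k Δ s d m) := ⟨delay 0⟩

theorem card_le : Fintype.card (SimVar k Δ s d m) ≤
    (Δ + 1) * k + s + (Δ + 1) + (d + 2) + (3 * m + 2) := by
  refine (Fintype.card_le_of_injective _ toSum_injective).trans ?_
  simp only [Fintype.card_sum, Fintype.card_prod, Fintype.card_fin]
  have : (Δ + 1) * k = Δ * k + k := by ring
  omega

/-- Numbering of the variables in which the state variables come first. -/
noncomputable def toNat : SimVar k Δ s d m ↪ ℕ where
  toFun X := Sum.elim (fun b : Fin k => (b : ℕ)) (fun Y => k + Fintype.equivFin _ Y) X.toSum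
  inj' := by
    refine Function.Injective.comp ?_ toSum_injective
    refine Function.Injective.sumElim Fin.val_injective ?_ ?_
    · intro X Y h
      exact (Fintype.equivFin _).injective (Fin.ext (Nat.add_left_cancel h))
    · intro b Y h
      have := b.2
      omega

/-- The state variables. -/
def stateEmb : Fin k ↪ SimVar k Δ s d m := ⟨state, fun _ _ h => by injection h⟩

theorem strictMono_toNat_stateEmb :
    StrictMono fun b : Fin k => toNat (stateEmb b : SimVar k Δ s d m) := fun _ _ h => h

end SimVar

namespace MPC

open Schema SimVar

variable {PROP : Type v} [LinearOrder PROP] {Pi : Finset PROP} {Delta : ℕ} (C : MPC Pi Delta)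
  (ID : Set PROP)

/-- The variables of the program that simulates `C`. -/
abbrev Var : Type :=
  SimVar C.k Delta C.circuit.size C.circuit.depth (distinguished ID Pi).card

/-- The circuit has been evaluated. -/
def evaluated : Schema Pi (C.Var ID) := var (delay (Fin.last _))

/-- The counter has run through all identifiers. -/
noncomputable def counted : Schema Pi (C.Var ID) := var (carry (Fin.last _))

/-- The identifier is the current value of the counter. -/
noncomputable def called : Schema Pi (C.Var ID) := var (agree (Fin.last _))

/-- The value of an input gate. -/
noncomputable def inputSchema : Fin (Pi.card + (Delta + 1) * C.k) → Schema Pi (C.Var ID) :=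
  Fin.append (fun i => prop (Pi.orderIsoOfFin rfl i)) fun i =>
    Fin.cases (motive := fun _ => Schema Pi (C.Var ID)) (var (state (finProdFinEquiv.symm i).2))
      (fun j => var (slot j (finProdFinEquiv.symm i).2)) (finProdFinEquiv.symm i).1

/-- The value of a gate in terms of the values of its children. -/
noncomputable def gateSchema (g : Fin C.circuit.size) : Schema Pi (C.Var ID) :=
  match hk : C.circuit.kind g with
  | .input => C.inputSchema ID (C.circuit.inputs.symm ⟨g, hk⟩)
  | .and => conj ((C.circuit.child g).toList.map fun h => var (gate h))
  | .or => disj ((C.circuit.child g).toList.map fun h => var (gate h))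
  | .not => neg (disj ((C.circuit.child g).toList.map fun h => var (gate h)))

/-- Iteration clauses of the simulating program. -/
noncomputable def simStep : C.Var ID → Schema Pi (C.Var ID)
  | state b => cond (C.evaluated ID) (var (gate (C.circuit.outputs b))) (var (state b))
  | slot j b => and (neg (C.evaluated ID)) (or (var (slot j b))
      (and (var (flag j.castSucc)) (dia (and (C.called ID) (var (state b))))))
  | gate g => C.gateSchema ID g
  | flag j => Fin.cases (motive := fun _ => Schema Pi (C.Var ID))
      (or (C.evaluated ID) (and (var (flag 0)) (neg (dia (C.called ID)))))
      (fun j => and (neg (C.evaluated ID))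
        (cond (dia (C.called ID)) (var (flag j.castSucc)) (var (flag j.succ)))) j
  | delay j => Fin.cases (motive := fun _ => Schema Pi (C.Var ID))
      (C.counted ID) (fun j => var (delay j.castSucc)) j
  | bit i => and (neg (C.counted ID))
      (cond (var (carry i.castSucc)) (neg (var (bit i))) (var (bit i)))
  | carry i => Fin.cases (motive := fun _ => Schema Pi (C.Var ID))
      (and (neg (C.counted ID)) (or (var (carry 0)) (C.evaluated ID)))
      (fun i => and (neg (C.counted ID)) (and (var (bit i)) (var (carry i.castSucc)))) i
  | agree i => Fin.cases (motive := fun _ => Schema Pi (C.Var ID))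
      (and (neg (C.counted ID)) (or (var (agree 0)) (C.evaluated ID)))
      (fun i => and (neg (C.counted ID)) (and (var (agree i.castSucc))
        (cond (var (bit i)) (prop (KripkeModel.identSymbol ID i))
          (neg (prop (KripkeModel.identSymbol ID i)))))) i

open Classical in
/-- Terminal clauses of the simulating program. -/
noncomputable def simInit (X : C.Var ID) : ML Pi := if X = delay 0 then top else bot

/-- The program that simulates `C`. -/
noncomputable def simProgram : MSCProgram Pi :=
  MSCProgram.ofVars SimVar.toNat (C.simInit ID) (C.simStep ID)
    (C.attention.map SimVar.stateEmb) (C.print.map SimVar.stateEmb)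

/-! ### Length -/

theorem length_gateSchema_le {c : ℕ} (hc : C.circuit.FanInLE c) (g : Fin C.circuit.size) :
    (C.gateSchema ID g).length ≤ 3 * c + 3 := by
  have h := hc g
  rw [gateSchema]
  split
  · rename_i hk
    generalize C.circuit.inputs.symm ⟨g, hk⟩ = i
    suffices h : (C.inputSchema ID i).length = 1 by omega
    rw [inputSchema]
    refine Fin.addCases (fun i => ?_) (fun i => ?_) i
    · rw [Fin.append_left]; rfl
    · rw [Fin.append_right]
      generalize (finProdFinEquiv.symm i).1 = j
      cases j using Fin.cases <;> rfl
  · rw [length_conj_map_var, Finset.length_toList]; omega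
  · rw [length_disj_map_var, Finset.length_toList]; omega
  · rw [Schema.length, length_disj_map_var, Finset.length_toList]; omega

theorem length_simStep_le {c : ℕ} (hc : C.circuit.FanInLE c) (X : C.Var ID) :
    (C.simStep ID X).length ≤ 3 * c + 30 := by
  have h : ∀ n, n ≤ 30 → n ≤ 3 * c + 30 := fun n hn => by omega
  cases X with
  | gate g => exact (C.length_gateSchema_le ID hc g).trans (by omega)
  | state b => exact h _ (by simp [simStep, Schema.length, Schema.cond, Schema.or, evaluated])
  | slot j b =>
    exact h _ (by simp [simStep, Schema.length, Schema.or, evaluated, called])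
  | flag j =>
    refine h _ ?_
    cases j using Fin.cases <;>
      simp [simStep, Schema.length, Schema.cond, Schema.or, evaluated, called]
  | delay j =>
    refine h _ ?_
    cases j using Fin.cases <;> simp [simStep, Schema.length, counted]
  | bit i => exact h _ (by simp [simStep, Schema.length, Schema.cond, Schema.or, counted])
  | carry i =>
    refine h _ ?_
    cases i using Fin.cases <;>
      simp [simStep, Schema.length, Schema.or, evaluated, counted]
  | agree i =>
    refine h _ ?_
    cases i using Fin.cases <;>
      simp [simStep, Schema.length, Schema.cond, Schema.or, evaluated, counted]

theorem length_simProgram_le {c : ℕ} (hc : C.circuit.FanInLE c) (hpos : 0 < C.circuit.size) :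
    (C.simProgram ID).length ≤ (3 * c + 34) * 10 * C.circuit.size := by
  have h₁ : (C.simProgram ID).length ≤ (3 * c + 34) * Fintype.card (C.Var ID) := by
    -- The constant `34` is `30` from the iteration clause, `2` from the terminal body and `2` for
    -- the head occurrences.
    refine MSCProgram.length_ofVars_le _ _ _ _ _ fun X => ?_
    have h₁ := C.length_simStep_le ID hc X
    have h₂ : (C.simInit ID X).length ≤ 2 := by
      rw [simInit]
      split_ifs <;> simp [bot, Schema.length]
    omega
  refine h₁.trans ?_
  rw [mul_assoc]
  refine Nat.mul_le_mul_left _ (SimVar.card_le.trans ?_)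
  -- Slots and states are paid for by the `(Δ + 1) * k` input gates. The flags are as well, since a
  -- nonempty circuit has `k > 0`; the identifier bits are paid for by the inputs for `Π`.
  have hk := C.circuit.outputs_pos hpos
  have hd := C.circuit.depth_lt_size hpos
  have hi := C.circuit.inputs_le_size
  have hm : (distinguished ID Pi).card ≤ Pi.card :=
    Finset.card_le_card fun p hp => mem_of_mem_distinguished hp
  have hD : Delta + 1 ≤ (Delta + 1) * C.k := Nat.le_mul_of_pos_right _ hk
  omega

end MPC

namespace MPC

open Schema SimVar

variable {PROP : Type v} [LinearOrder PROP] {Pi : Finset PROP} {Delta : ℕ} (C : MPC Pi Delta)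
  (ID : Set PROP) (M : KripkeModel.{u} Pi)

/-! ### One step of the simulating program -/

/-- The truth value of a variable of the simulating program at a node at time `t`. -/
abbrev simRun (t : ℕ) (X : C.Var ID) (w : M.W) : Prop :=
  MSCProgram.run (C.simInit ID) (C.simStep ID) M t X w

section Step

variable (t : ℕ) (w : M.W)

theorem simRun_zero (X : C.Var ID) : C.simRun ID M 0 X w ↔ X = delay 0 := by
  change M.Sat w (C.simInit ID X) ↔ _
  rw [simInit]
  split_ifs with h <;> simp [h, bot, KripkeModel.Sat]

theorem simRun_state (b : Fin C.k) : C.simRun ID M (t + 1) (state b) w ↔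
    (C.simRun ID M t (delay (Fin.last _)) w ∧ C.simRun ID M t (gate (C.circuit.outputs b)) w) ∨
    (¬ C.simRun ID M t (delay (Fin.last _)) w ∧ C.simRun ID M t (state b) w) := by
  simp [simRun, MSCProgram.run, simStep, evaluated]

theorem simRun_slot (j : Fin Delta) (b : Fin C.k) : C.simRun ID M (t + 1) (slot j b) w ↔
    ¬ C.simRun ID M t (delay (Fin.last _)) w ∧ (C.simRun ID M t (slot j b) w ∨
      (C.simRun ID M t (flag j.castSucc) w ∧ ∃ x, M.R w x ∧
        C.simRun ID M t (agree (Fin.last _)) x ∧ C.simRun ID M t (state b) x)) := by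
  simp [simRun, MSCProgram.run, simStep, evaluated, called]

theorem simRun_gate (g : Fin C.circuit.size) : C.simRun ID M (t + 1) (gate g) w ↔
    (C.gateSchema ID g).Holds M (C.simRun ID M t) w := Iff.rfl

theorem simRun_flag_zero : C.simRun ID M (t + 1) (flag 0) w ↔
    C.simRun ID M t (delay (Fin.last _)) w ∨ (C.simRun ID M t (flag 0) w ∧
      ¬ ∃ x, M.R w x ∧ C.simRun ID M t (agree (Fin.last _)) x) := by
  simp [simRun, MSCProgram.run, simStep, evaluated, called]

theorem simRun_flag_succ (j : Fin Delta) : C.simRun ID M (t + 1) (flag j.succ) w ↔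
    ¬ C.simRun ID M t (delay (Fin.last _)) w ∧
      (((∃ x, M.R w x ∧ C.simRun ID M t (agree (Fin.last _)) x) ∧
        C.simRun ID M t (flag j.castSucc) w) ∨
      ((¬ ∃ x, M.R w x ∧ C.simRun ID M t (agree (Fin.last _)) x) ∧
        C.simRun ID M t (flag j.succ) w)) := by
  simp [simRun, MSCProgram.run, simStep, evaluated, called]

theorem simRun_delay_zero : C.simRun ID M (t + 1) (delay 0) w ↔
    C.simRun ID M t (carry (Fin.last _)) w := Iff.rfl

theorem simRun_delay_succ (j : Fin (C.circuit.depth + 1)) :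
    C.simRun ID M (t + 1) (delay j.succ) w ↔ C.simRun ID M t (delay j.castSucc) w := Iff.rfl

theorem simRun_bit (i : Fin (distinguished ID Pi).card) : C.simRun ID M (t + 1) (bit i) w ↔
    ¬ C.simRun ID M t (carry (Fin.last _)) w ∧
      ¬ (C.simRun ID M t (bit i) w ↔ C.simRun ID M t (carry i.castSucc) w) := by
  simp only [simRun, MSCProgram.run, simStep, counted, holds_and, holds_neg, holds_cond, holds_var]
  tauto

theorem simRun_carry_zero : C.simRun ID M (t + 1) (carry 0) w ↔
    ¬ C.simRun ID M t (carry (Fin.last _)) w ∧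
      (C.simRun ID M t (carry 0) w ∨ C.simRun ID M t (delay (Fin.last _)) w) := by
  simp [simRun, MSCProgram.run, simStep, evaluated, counted]

theorem simRun_carry_succ (i : Fin (distinguished ID Pi).card) :
    C.simRun ID M (t + 1) (carry i.succ) w ↔ ¬ C.simRun ID M t (carry (Fin.last _)) w ∧
      (C.simRun ID M t (bit i) w ∧ C.simRun ID M t (carry i.castSucc) w) := by
  simp [simRun, MSCProgram.run, simStep, counted]

theorem simRun_agree_zero : C.simRun ID M (t + 1) (agree 0) w ↔
    ¬ C.simRun ID M t (carry (Fin.last _)) w ∧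
      (C.simRun ID M t (agree 0) w ∨ C.simRun ID M t (delay (Fin.last _)) w) := by
  simp [simRun, MSCProgram.run, simStep, evaluated, counted]

theorem simRun_agree_succ (i : Fin (distinguished ID Pi).card) :
    C.simRun ID M (t + 1) (agree i.succ) w ↔ ¬ C.simRun ID M t (carry (Fin.last _)) w ∧
      (C.simRun ID M t (agree i.castSucc) w ∧
        (C.simRun ID M t (bit i) w ↔ (M.identNum ID w).testBit i = true)) := by
  simp only [simRun, MSCProgram.run, simStep, counted, KripkeModel.testBit_identNum,
    Fin.cases_succ, holds_and, holds_neg, holds_cond, holds_var, holds_prop]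
  tauto

end Step

/-! ### The clock -/

/-- At time `s`, the pulse is at position `j` and the counter is off. -/
def Waiting (s j : ℕ) : Prop :=
  ∀ w : M.W, (∀ i, C.simRun ID M s (delay i) w ↔ (i : ℕ) = j) ∧
    (∀ i, ¬ C.simRun ID M s (bit i) w) ∧ (∀ i, ¬ C.simRun ID M s (carry i) w) ∧
    ∀ i, ¬ C.simRun ID M s (agree i) w

/-- At time `s`, the counter has been running for `t` time steps. -/
def Counting (s t : ℕ) : Prop :=
  ∀ w : M.W, (∀ i, ¬ C.simRun ID M s (delay i) w) ∧
    (∀ i, C.simRun ID M s (bit i) w ↔ (t - i).testBit i = true) ∧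
    (∀ i, C.simRun ID M s (carry i) w ↔ i ≤ t ∧ ∀ j < (i : ℕ), (t - i).testBit j = true) ∧
    ∀ i, C.simRun ID M s (agree i) w ↔
      i ≤ t ∧ ∀ j < (i : ℕ), (t - i).testBit j = (M.identNum ID w).testBit j

/-- The number of time steps in which the program simulates one communication round. -/
noncomputable def simPeriod : ℕ :=
  C.circuit.depth + 2 + ((distinguished ID Pi).card + 2 ^ (distinguished ID Pi).card)

variable {C ID M}

theorem Waiting.succ {s j : ℕ} (h : C.Waiting ID M s j) (hj : j < C.circuit.depth + 1) :
    C.Waiting ID M (s + 1) (j + 1) := by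
  intro w
  obtain ⟨hd, hb, hc, ha⟩ := h w
  refine ⟨fun i => ?_, fun i => ?_, fun i => ?_, fun i => ?_⟩
  · cases i using Fin.cases with
    | zero => simp [simRun_delay_zero, hc]
    | succ i => simp [simRun_delay_succ, hd]
  · simp [simRun_bit, hb, hc]
  · cases i using Fin.cases with
    | zero => simp [simRun_carry_zero, hc, hd, hj.ne']
    | succ i => simp [simRun_carry_succ, hb]
  · cases i using Fin.cases with
    | zero => simp [simRun_agree_zero, ha, hd, hj.ne']
    | succ i => simp [simRun_agree_succ, ha]

theorem Waiting.counting {s : ℕ} (h : C.Waiting ID M s (C.circuit.depth + 1)) :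
    C.Counting ID M (s + 1) 0 := by
  intro w
  obtain ⟨hd, hb, hc, ha⟩ := h w
  refine ⟨fun i => ?_, fun i => ?_, fun i => ?_, fun i => ?_⟩
  · cases i using Fin.cases with
    | zero => simp [simRun_delay_zero, hc]
    | succ i => simp [simRun_delay_succ, hd, i.2.ne]
  · simp [simRun_bit, hb, hc]
  · cases i using Fin.cases with
    | zero => simp [simRun_carry_zero, hc, hd]
    | succ i => simp [simRun_carry_succ, hb]
  · cases i using Fin.cases with
    | zero => simp [simRun_agree_zero, hc, hd]
    | succ i => simp [simRun_agree_succ, ha]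

/-- The carry out of the top bit appears when `t - m` has only ones, that is, at the last counter
value `2 ^ m - 1`. -/
theorem Counting.counted_iff {s t : ℕ} (h : C.Counting ID M s t)
    (ht : t < (distinguished ID Pi).card + 2 ^ (distinguished ID Pi).card) (w : M.W) :
    C.simRun ID M s (carry (Fin.last _)) w ↔
      t + 1 = (distinguished ID Pi).card + 2 ^ (distinguished ID Pi).card := by
  have hpos : 0 < 2 ^ (distinguished ID Pi).card := by positivity
  rw [(h w).2.2.1, Fin.val_last, forall_testBit_iff_of_lt (by omega)]
  omega

theorem Counting.called_iff {s t : ℕ} (h : C.Counting ID M s t)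
    (ht : t < (distinguished ID Pi).card + 2 ^ (distinguished ID Pi).card) (w : M.W) :
    C.simRun ID M s (agree (Fin.last _)) w ↔
      t = (distinguished ID Pi).card + M.identNum ID w := by
  have hpos : 0 < 2 ^ (distinguished ID Pi).card := by positivity
  rw [(h w).2.2.2, Fin.val_last, M.forall_testBit_eq_identNum_iff ID (by omega)]
  omega

/-- Position `i + 1` at time `t + 1` and position `i` at time `t` refer to the same number `t - i`,
so carry and comparison each extend a known prefix by one bit. Bit `i` itself moves from `t - i` to
its successor by `testBit_succ_iff`. -/
theorem Counting.succ {s t : ℕ} (h : C.Counting ID M s t)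
    (ht : t + 1 < (distinguished ID Pi).card + 2 ^ (distinguished ID Pi).card) :
    C.Counting ID M (s + 1) (t + 1) := by
  intro w
  have hr : ¬ C.simRun ID M s (carry (Fin.last _)) w := by
    rw [h.counted_iff (by omega)]
    omega
  obtain ⟨hd, hb, hc, ha⟩ := h w
  refine ⟨fun i => ?_, fun i => ?_, fun i => ?_, fun i => ?_⟩
  · cases i using Fin.cases with
    | zero => simpa [simRun_delay_zero] using hr
    | succ i => simp [simRun_delay_succ, hd]
  · rw [simRun_bit, hb, hc i.castSucc, Fin.val_castSucc]
    by_cases hi : (i : ℕ) ≤ t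
    · rw [Nat.sub_add_comm hi, testBit_succ_iff]
      simp [hr, hi]
    -- The pipeline has not reached bit `i`: both truncated differences are `0` and no carry has
    -- arrived.
    · rw [Nat.sub_eq_zero_of_le (by omega), Nat.sub_eq_zero_of_le (by omega)]
      simp [hi]
  · cases i using Fin.cases with
    | zero => simp [simRun_carry_zero, hc 0, hr]
    | succ i =>
      rw [simRun_carry_succ, hb, hc i.castSucc, Fin.val_castSucc, Fin.val_succ, Nat.add_sub_add_right,
        Nat.forall_lt_succ_right]
      simp only [hr, not_false_eq_true, true_and, Nat.add_le_add_iff_right]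
      tauto
  · cases i using Fin.cases with
    | zero => simp [simRun_agree_zero, ha, hr]
    | succ i =>
      rw [simRun_agree_succ, hb, ha, Fin.val_castSucc, Fin.val_succ, Nat.add_sub_add_right,
        Nat.forall_lt_succ_right, Bool.eq_iff_iff (a := (t - i).testBit i)
          (b := (M.identNum ID w).testBit i)]
      simp only [hr, not_false_eq_true, true_and, Nat.add_le_add_iff_right]
      tauto

theorem Counting.waiting {s t : ℕ} (h : C.Counting ID M s t)
    (ht : t + 1 = (distinguished ID Pi).card + 2 ^ (distinguished ID Pi).card) :
    C.Waiting ID M (s + 1) 0 := by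
  intro w
  have hr : C.simRun ID M s (carry (Fin.last _)) w := by
    rw [h.counted_iff (by omega)]
    omega
  obtain ⟨hd, hb, hc, ha⟩ := h w
  refine ⟨fun i => ?_, fun i => ?_, fun i => ?_, fun i => ?_⟩
  · cases i using Fin.cases with
    | zero => simpa [simRun_delay_zero] using hr
    | succ i => simp [simRun_delay_succ, hd]
  · simp [simRun_bit, hr]
  · cases i using Fin.cases with
    | zero => simp [simRun_carry_zero, hr]
    | succ i => simp [simRun_carry_succ, hr]
  · cases i using Fin.cases with
    | zero => simp [simRun_agree_zero, hr]
    | succ i => simp [simRun_agree_succ, hr]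

theorem Waiting.add {s : ℕ} (h : C.Waiting ID M s 0) {t : ℕ} (ht : t ≤ C.circuit.depth + 1) :
    C.Waiting ID M (s + t) t := by
  induction t with
  | zero => exact h
  | succ t ih => exact (ih (by omega)).succ (by omega)

theorem Waiting.counting_add {s : ℕ} (h : C.Waiting ID M s 0) {t : ℕ}
    (ht : t < (distinguished ID Pi).card + 2 ^ (distinguished ID Pi).card) :
    C.Counting ID M (s + (C.circuit.depth + 2) + t) t := by
  induction t with
  | zero => exact (h.add le_rfl).counting
  | succ t ih => exact (ih (by omega)).succ ht

theorem Waiting.add_period {s : ℕ} (h : C.Waiting ID M s 0) :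
    C.Waiting ID M (s + C.simPeriod ID) 0 := by
  have hpos : 0 < 2 ^ (distinguished ID Pi).card := by positivity
  -- The last counting step, at which the overflow resets the counter and launches the next pulse.
  have := (h.counting_add (t := (distinguished ID Pi).card +
    2 ^ (distinguished ID Pi).card - 1) (by omega)).waiting (by omega)
  convert this using 1
  rw [simPeriod]
  omega

variable (C ID M)

theorem waiting_mul_period (n : ℕ) : C.Waiting ID M (n * C.simPeriod ID) 0 := by
  induction n with
  | zero =>
    intro w
    simp only [Nat.zero_mul, simRun_zero, delay.injEq, reduceCtorEq, not_false_eq_true,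
      implies_true, and_true, Fin.ext_iff, Fin.val_zero]
  | succ n ih =>
    rw [Nat.succ_mul]
    exact ih.add_period

/-! ### The data -/

/-- At time `s`, the strings `r w 0, …, r w Δ` are stored at each node `w`. -/
def Stores (s : ℕ) (r : M.W → Fin (Delta + 1) → Fin C.k → Bool) : Prop :=
  ∀ w b, (C.simRun ID M s (state b) w ↔ r w 0 b = true) ∧
    ∀ j, C.simRun ID M s (slot j b) w ↔ r w j.succ b = true

variable {C ID M}

theorem holds_inputSchema {s : ℕ} {r : M.W → Fin (Delta + 1) → Fin C.k → Bool}
    (h : C.Stores ID M s r) (w : M.W) (i : Fin (Pi.card + (Delta + 1) * C.k)) :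
    (C.inputSchema ID i).Holds M (C.simRun ID M s) w ↔
      C.inputString (M.localInput w) (r w) i = true := by
  rw [inputSchema, inputString]
  refine Fin.addCases (fun i => ?_) (fun i => ?_) i
  · rw [Fin.append_left, Fin.append_left]
    exact (@decide_eq_true_iff _ (Classical.propDecidable _)).symm
  · rw [Fin.append_right, Fin.append_right]
    generalize (finProdFinEquiv.symm i).1 = j
    cases j using Fin.cases with
    | zero => exact (h w _).1
    | succ j => exact (h w _).2 j

theorem holds_gateSchema {s : ℕ} {r : M.W → Fin (Delta + 1) → Fin C.k → Bool}
    (h : C.Stores ID M s r) (w : M.W) (g : Fin C.circuit.size)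
    (hg : ∀ h ∈ C.circuit.child g, C.simRun ID M s (gate h) w ↔
      C.circuit.value (C.inputString (M.localInput w) (r w)) h = true) :
    (C.gateSchema ID g).Holds M (C.simRun ID M s) w ↔
      C.circuit.value (C.inputString (M.localInput w) (r w)) g = true := by
  rw [gateSchema]
  split
  · rename_i hk
    rw [C.circuit.value_input _ hk, holds_inputSchema h]
  · rename_i hk
    rw [C.circuit.value_and_iff _ hk]
    simpa using forall₂_congr hg
  · rename_i hk
    rw [C.circuit.value_or_iff _ hk]
    simpa using exists_congr fun h => and_congr_right (hg h)
  · rename_i hk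
    rw [C.circuit.value_not_iff _ hk, holds_neg]
    refine not_congr ?_
    simpa using exists_congr fun h => and_congr_right (hg h)

/-- While the pulse is under way, the stored strings are frozen: nothing is loaded, and no node is
called. Correct gate values therefore spread upwards one height level per step. -/
theorem Stores.add {s : ℕ} (hs : C.Waiting ID M s 0)
    {r : M.W → Fin (Delta + 1) → Fin C.k → Bool} (h : C.Stores ID M s r) {t : ℕ}
    (ht : t ≤ C.circuit.depth + 1) :
    C.Stores ID M (s + t) r ∧ ∀ w g, C.circuit.height g < t →
      (C.simRun ID M (s + t) (gate g) w ↔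
        C.circuit.value (C.inputString (M.localInput w) (r w)) g = true) := by
  induction t with
  | zero => exact ⟨h, fun w g hg => absurd hg (Nat.not_lt_zero _)⟩
  | succ t ih =>
    obtain ⟨ih₁, ih₂⟩ := ih (by omega)
    have hw := hs.add (t := t) (by omega)
    have hd (w : M.W) : ¬ C.simRun ID M (s + t) (delay (Fin.last _)) w := by
      rw [(hw w).1, Fin.val_last]
      omega
    rw [← Nat.add_assoc]
    refine ⟨fun w b => ⟨?_, fun j => ?_⟩, fun w g hg => ?_⟩
    · simp [simRun_state, hd, (ih₁ w b).1]
    · simp [simRun_slot, hd, (ih₁ w b).2, (hw _).2.2.2]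
    · rw [simRun_gate]
      refine holds_gateSchema ih₁ w g fun h hh => ih₂ w h ?_
      have := C.circuit.height_lt hh
      omega

/-- The successors of `w` that have been met when the counter has been running for `t` steps. -/
def met (M : KripkeModel.{u} Pi) (ID : Set PROP) (w : M.W) (t : ℕ) : Set M.W :=
  {x ∈ M.succ w | (distinguished ID Pi).card + M.identNum ID x < t}

theorem met_succ_of_not_exists {w : M.W} {t : ℕ}
    (h : ¬ ∃ x, M.R w x ∧ t = (distinguished ID Pi).card + M.identNum ID x) :
    met M ID w (t + 1) = met M ID w t := by
  ext x
  refine and_congr_right fun hx => ?_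
  have : t ≠ (distinguished ID Pi).card + M.identNum ID x := fun ht => h ⟨x, hx, ht⟩
  omega

/-- Distinct identifiers ensure that a call adds exactly one successor. -/
theorem ncard_met_succ (hM : M.MemK ID Delta) {w x : M.W} {t : ℕ} (hx : M.R w x)
    (ht : t = (distinguished ID Pi).card + M.identNum ID x) :
    (met M ID w (t + 1)).ncard = (met M ID w t).ncard + 1 := by
  have := hM.finite
  have hins : met M ID w (t + 1) = insert x (met M ID w t) := by
    ext y
    rw [Set.mem_insert_iff]
    constructor
    · rintro ⟨hy, hlt⟩
      by_cases hyx : y = x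
      · exact .inl hyx
      · have := (M.identNum_injective ID hM.ident_injective).ne hyx
        exact .inr ⟨hy, by omega⟩
    · rintro (rfl | ⟨hy, hlt⟩)
      · exact ⟨hx, by omega⟩
      · exact ⟨hy, by omega⟩
  rw [hins, Set.ncard_insert_of_notMem _ (Set.toFinite _)]
  rintro ⟨-, hlt⟩
  omega

/-- When `x` is called, the successors already met are exactly those with smaller identifiers, so
their number is the rank of `x` counted from `0`. -/
theorem isNeighbour_iff {w x : M.W} {j : ℕ} (hx : M.R w x) :
    M.IsNeighbour ID w (j + 1) x ↔
      (met M ID w ((distinguished ID Pi).card + M.identNum ID x)).ncard = j := by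
  have : met M ID w ((distinguished ID Pi).card + M.identNum ID x) =
      {y ∈ M.succ w | M.ident ID y < M.ident ID x} := by
    ext y
    refine and_congr_right fun _ => ?_
    rw [Nat.add_lt_add_iff_left, M.identNum_lt_iff]
  rw [this, KripkeModel.IsNeighbour]
  constructor
  · rintro ⟨-, h⟩
    omega
  · rintro h
    exact ⟨hx, by omega⟩

/-- Induction on the counter time: a call advances the flag by one, and the flag before the call
selects the slot. States stay fixed while counting, so a called node still shows `f`. -/
theorem Stores.collect (hM : M.MemK ID Delta) {s : ℕ} (hs : C.Waiting ID M s 0)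
    {r : M.W → Fin (Delta + 1) → Fin C.k → Bool} (h : C.Stores ID M s r)
    {f : M.W → Fin C.k → Bool}
    (hf : ∀ w, f w = C.circuit.eval (C.inputString (M.localInput w) (r w))) {t : ℕ}
    (ht : t ≤ (distinguished ID Pi).card + 2 ^ (distinguished ID Pi).card) (w : M.W) :
    (∀ b, C.simRun ID M (s + (C.circuit.depth + 2) + t) (state b) w ↔ f w b = true) ∧
    (∀ j, C.simRun ID M (s + (C.circuit.depth + 2) + t) (flag j) w ↔
      (met M ID w t).ncard = j) ∧
    ∀ j b, C.simRun ID M (s + (C.circuit.depth + 2) + t) (slot j b) w ↔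
      ∃ x, (distinguished ID Pi).card + M.identNum ID x < t ∧
        M.IsNeighbour ID w (j + 1) x ∧ f x b = true := by
  induction t generalizing w with
  | zero =>
    obtain ⟨h₁, h₂⟩ := h.add hs le_rfl
    -- The pulse is at its last position `d + 1`, when all gates of height at most `d`, hence all
    -- outputs, are correct. This step loads them, empties the slots and sets flag `0`.
    have hd : C.simRun ID M (s + (C.circuit.depth + 1)) (delay (Fin.last _)) w :=
      ((hs.add le_rfl) w).1 _ |>.2 rfl
    have ht : s + (C.circuit.depth + 2) + 0 = s + (C.circuit.depth + 1) + 1 := by omega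
    rw [ht]
    refine ⟨fun b => ?_, fun j => ?_, fun j b => ?_⟩
    · rw [simRun_state, h₂ w _ (Nat.lt_succ_of_le (C.circuit.height_output_le_depth b)), hf]
      simp [hd, Circuit.eval]
    · have : (met M ID w 0).ncard = 0 := by simp [met]
      rw [this]
      cases j using Fin.cases with
      | zero => simp [simRun_flag_zero, hd]
      | succ j => simp [simRun_flag_succ, hd]
    · simp [simRun_slot, hd]
  | succ t ih =>
    have hc := hs.counting_add (t := t) (by omega)
    have hd := (hc w).1
    have hcall := hc.called_iff (by omega)
    have ihw := ih (by omega) w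
    rw [← Nat.add_assoc]
    refine ⟨fun b => ?_, fun j => ?_, fun j b => ?_⟩
    · simp [simRun_state, hd, ihw.1]
    · by_cases hx : ∃ x, M.R w x ∧ t = (distinguished ID Pi).card + M.identNum ID x
      · have hn : (met M ID w (t + 1)).ncard = (met M ID w t).ncard + 1 := by
          obtain ⟨x, hx, ht⟩ := hx
          exact ncard_met_succ hM hx ht
        rw [hn]
        cases j using Fin.cases with
        | zero => simp [simRun_flag_zero, hd, hcall, hx]
        | succ j => simp [simRun_flag_succ, hd, hcall, hx, ihw.2.1]
      · rw [met_succ_of_not_exists hx]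
        cases j using Fin.cases with
        | zero => simp only [simRun_flag_zero, hd, hcall, hx, ihw.2.1]; simp
        | succ j => simp only [simRun_flag_succ, hd, hcall, hx, ihw.2.1]; simp
    · rw [simRun_slot, ihw.2.1, ihw.2.2]
      simp only [hd, hcall, not_false_eq_true, true_and, Fin.val_castSucc]
      constructor
      · rintro (⟨x, hlt, hx⟩ | ⟨hn, x, hR, hx, hfx⟩)
        · exact ⟨x, by omega, hx⟩
        · refine ⟨x, by omega, (isNeighbour_iff hR).2 (hx ▸ hn), ?_⟩
          exact ((ih (by omega) x).1 b).1 hfx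
      · rintro ⟨x, hlt, hx, hfx⟩
        by_cases htx : t = (distinguished ID Pi).card + M.identNum ID x
        · exact .inr ⟨htx ▸ (isNeighbour_iff hx.1).1 hx, x, hx.1, htx,
            ((ih (by omega) x).1 b).2 hfx⟩
        · exact .inl ⟨x, by omega, hx, hfx⟩

theorem Stores.add_period (hM : M.MemK ID Delta) {s : ℕ} (hs : C.Waiting ID M s 0)
    {r : M.W → Fin (Delta + 1) → Fin C.k → Bool} (h : C.Stores ID M s r)
    {f : M.W → Fin C.k → Bool}
    (hf : ∀ w, f w = C.circuit.eval (C.inputString (M.localInput w) (r w))) :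
    C.Stores ID M (s + C.simPeriod ID) (C.received ID M f) := by
  intro w b
  obtain ⟨h₁, -, h₂⟩ := h.collect hM hs hf le_rfl w
  rw [simPeriod, ← Nat.add_assoc]
  refine ⟨?_, fun j => ?_⟩
  · rw [h₁]
    simp [received]
  · rw [h₂]
    simp only [received, Fin.val_succ, Nat.succ_ne_zero, if_false, Nat.add_lt_add_iff_left,
      M.identNum_lt, true_and, decide_eq_true_eq]

/-! ### Synchronisation with the rounds of the circuit -/

variable (C ID M)

/-- The strings on which the circuit is evaluated in round `n`. -/
noncomputable def roundStrings : ℕ → M.W → Fin (Delta + 1) → Fin C.k → Bool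
  | 0 => fun _ _ _ => false
  | n + 1 => C.received ID M (C.config ID M n)

theorem config_eq_eval (n : ℕ) (w : M.W) : C.config ID M n w =
    C.circuit.eval (C.inputString (M.localInput w) (C.roundStrings ID M n w)) := by
  cases n <;> rfl

variable {ID M}

theorem stores_roundStrings (hM : M.MemK ID Delta) (n : ℕ) :
    C.Stores ID M (n * C.simPeriod ID) (C.roundStrings ID M n) := by
  induction n with
  | zero =>
    intro w b
    simp [simRun_zero, roundStrings]
  | succ n ih =>
    rw [Nat.succ_mul]
    exact ih.add_period hM (C.waiting_mul_period ID M n) (C.config_eq_eval ID M n)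

/-- Until the first load the states are the zero strings on which round `0` is evaluated; this
silence prevents premature acceptance. -/
theorem simRun_state_of_lt (hM : M.MemK ID Delta) {t : ℕ} (ht : t < C.circuit.depth + 2)
    (b : Fin C.k) (w : M.W) : ¬ C.simRun ID M t (state b) w := by
  have hs := C.waiting_mul_period ID M 0
  have h := ((C.stores_roundStrings hM 0).add hs (t := t) (by omega)).1 w b
  rw [Nat.zero_mul, Nat.zero_add] at h
  rw [h.1]
  simp [roundStrings]

theorem simRun_state_iff (hM : M.MemK ID Delta) (n : ℕ) {t : ℕ} (ht : t < C.simPeriod ID)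
    (b : Fin C.k) (w : M.W) :
    C.simRun ID M (C.circuit.depth + 2 + n * C.simPeriod ID + t) (state b) w ↔
      C.config ID M n w b = true := by
  by_cases hc : t ≤ (distinguished ID Pi).card + 2 ^ (distinguished ID Pi).card
  · rw [← ((C.stores_roundStrings hM n).collect hM (C.waiting_mul_period ID M n)
      (C.config_eq_eval ID M n) hc w).1 b, Nat.add_comm (C.circuit.depth + 2)]
  -- The rest of the block overlaps the evaluation phase of round `n + 1`, where the old state is
  -- kept as received string `0`.
  · obtain ⟨t', rfl⟩ := Nat.exists_eq_add_of_le (not_le.1 hc).le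
    have ht' : t' ≤ C.circuit.depth + 1 := by
      rw [simPeriod] at ht
      omega
    have h := (((C.stores_roundStrings hM (n + 1)).add (C.waiting_mul_period ID M (n + 1))
      ht').1 w b).1
    have heq : C.circuit.depth + 2 + n * C.simPeriod ID + ((distinguished ID Pi).card +
        2 ^ (distinguished ID Pi).card + t') = (n + 1) * C.simPeriod ID + t' := by
      have hn := Nat.add_one_mul n (C.simPeriod ID)
      have : C.simPeriod ID = C.circuit.depth + 2 + ((distinguished ID Pi).card +
        2 ^ (distinguished ID Pi).card) := rfl
      omega
    rw [heq, h]
    simp [roundStrings, received]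

variable (ID)

theorem simPeriod_le :
    C.simPeriod ID ≤ 4 * (C.circuit.depth + 2 ^ (distinguished ID Pi).card) := by
  have : (distinguished ID Pi).card < 2 ^ (distinguished ID Pi).card := Nat.lt_two_pow_self
  rw [simPeriod]
  omega

variable {ID}

open Classical in
/-- The simulating program stretches the sequence of states of the circuit by the factor
`simPeriod` and delays it by `depth + 2` time steps. -/
theorem outputs_simProgram (hM : M.MemK ID Delta) (w : M.W) (s : List Bool) :
    (∀ n, C.Outputs ID M w n s →
      (C.simProgram ID).Outputs M w (C.circuit.depth + 2 + n * C.simPeriod ID) s) ∧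
    ∀ t, (C.simProgram ID).Outputs M w t s → ∃ n, C.Outputs ID M w n s := by
  have hQ : 0 < C.simPeriod ID := by rw [simPeriod]; positivity
  have hout := MSCProgram.outputs_ofVars_iff SimVar.toNat (C.simInit ID) (C.simStep ID) M
    SimVar.stateEmb SimVar.strictMono_toNat_stateEmb C.attention C.print w
    (fun t b => decide (C.simRun ID M t (state b) w)) (fun _ _ => decide_eq_true_iff)
  have h₀ : ∀ t < C.circuit.depth + 2, ∀ b,
      decide (C.simRun ID M t (state b) w) = false := fun t ht b =>
    decide_eq_false (C.simRun_state_of_lt hM ht b w)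
  have h : ∀ n, ∀ t < C.simPeriod ID, (fun b => decide (C.simRun ID M
      (C.circuit.depth + 2 + n * C.simPeriod ID + t) (state b) w)) = C.config ID M n w := by
    intro n t ht
    funext b
    rw [Bool.eq_iff_iff, decide_eq_true_iff, C.simRun_state_iff hM n ht]
  exact ⟨fun n ho => (hout _ s).2 (outputsAt_of_stretch hQ h₀ h ho),
    fun t ho => exists_outputsAt_of_stretch hQ h₀ h ((hout t s).1 ho)⟩

end MPC

/-! ### Conclusion -/

theorem mainTheorem1 {PROP : Type v} [LinearOrder PROP] (ID : Set PROP) :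
    ∃ (T : ℕ) (K : ℕ → ℕ), ∀ (Pi : Finset PROP) (Delta : ℕ) (C : MPC Pi Delta),
      ∃ L : MSCProgram Pi,
        MPC.Equivalent.{u} C ID L ∧
        (∀ c : ℕ, C.circuit.FanInLE c → 0 < C.circuit.size →
          L.length ≤ K c * C.circuit.size) ∧
        (∀ M : KripkeModel.{u} Pi, M.MemK ID Delta →
          ∀ (w : M.W) (n : ℕ) (s : List Bool), C.Outputs ID M w n s →
            ∃ n' : ℕ, L.Outputs M w n' s ∧
              n' + 1 ≤ T * (C.circuit.depth + 2 ^ (distinguished ID Pi).card) * (n + 1)) := by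
  refine ⟨4, fun c => (3 * c + 34) * 10, fun Pi Delta C => ⟨C.simProgram ID, ?_,
    fun c => C.length_simProgram_le ID, ?_⟩⟩
  · intro M hM w s
    obtain ⟨h₁, h₂⟩ := C.outputs_simProgram hM w s
    exact ⟨fun ⟨n, hn⟩ => ⟨_, h₁ n hn⟩, fun ⟨t, ht⟩ => h₂ t ht⟩
  · intro M hM w n s hn
    refine ⟨_, (C.outputs_simProgram hM w s).1 n hn, ?_⟩
    -- It suffices that `n' + 1` is at most `n + 1` periods; the offset `d + 2` plus one fits into
    -- one period because `2 ^ m` is positive.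
    refine le_trans ?_ (Nat.mul_le_mul_right _ (C.simPeriod_le ID))
    have hpos : 0 < 2 ^ (distinguished ID Pi).card := by positivity
    have h : C.simPeriod ID = C.circuit.depth + 2 + ((distinguished ID Pi).card +
      2 ^ (distinguished ID Pi).card) := rfl
    rw [Nat.mul_succ, Nat.mul_comm n]
    omega
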